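/- **Setting.** Let $D \ge 1$ and $d_\star \le D$. Let $\mathcal X \subset \mathbb R^D$ be finite with $\operatorname{span}(\mathcal X)=\mathbb R^D$, let $\mathcal Z \subset \mathbb R^D$, and let $\theta_\star \in \Theta_{d_\star} = \{\theta \in \mathbb R^D : \theta_i = 0 \ \forall i > d_\star\}$. Put $h(x) = \langle \theta_\star, x\rangle$. Assume that $h$ has a unique maximizer $z_\star$ over $\mathcal Z$, and that $\operatorname{span}\{z_\star - z : z \in \mathcal Z\} = \mathbb R^D$. For $d \le D$ let $\psi_d(x) \in \mathbb R^d$ consist of the first $d$ coordinates of $x$, let $\Delta_{\mathcal X}$ be the probability simplex over $\mathcal X$, let $A_d(\lambda) = \sum_{x\in\mathcal X} \lambda_x \psi_d(x)\psi_d(x)^\top$ for $\lambda\in\Delta_{\mathcal X}$, and let $$\rho^\star_d = \inf_{\lambda \in \Delta_{\mathcal X}} \ \sup_{z \in \mathcal Z\setminus\{z_\star\}} \frac{\|\psi_d(z_\star) - \psi_d(z)\|^2_{A_d(\lambda)^{-1}}}{(h(z_\star) - h(z))^2},$$ where $\|y\|^2_{A^{-1}} = y^\top A^{+} y$ with the pseudo-inverse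 $A^+$ if $y$ is in the range of $A$, and $\|y\|^2_{A^{-1}} = \infty$ otherwise. A *non-interactive algorithm* with feature dimension $d$, where $d_\star \le d \le D$, fixes $N$ and an allocation $x_1,\dots,x_N \in \mathcal X$ (possibly with knowledge of $\theta_\star$), observes independent rewards $r_i \sim \mathcal N(h(x_i),1)$, computes the least-squares estimator $\hat\theta_d = \operatorname{argmin}_{\theta\in\mathbb R^d} \sum_{i=1}^N (r_i - \langle\theta, \psi_d(x_i)\rangle)^2$, and recommends $\hat z \in \operatorname{argmax}_{z\in\mathcal Z} \langle \hat\theta_d, \psi_d(z)\rangle$, ties broken arbitrarily. **Theorem.** Let $\delta \in (0, 0.015]$ and $N \le \tfrac12\, \rho^\star_{d_\star} \log(1/\delta)$. 1. If the least-squares problem has a unique solution $\hat\theta_d$, then the algorithm makes a mistake with probability at least $\delta$, that is, $\mathbb P(\hat z \ne z_\star) \ge \delta$. 2. For every allocation, also when the least-squares problem has several solutions, with probability at least $\delta$ there is a least-squares solution $\hat\theta_d$ for which $z_\star$ is not the unique maximizer of $\langle \hat\theta_d, \psi_d(z)\rangle$ over $z \in \mathcal Z$. -/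

import Mathlib

open MeasureTheory ProbabilityTheory
open scoped ENNReal

noncomputable section

namespace LinearBandit

/-- The truncation `ψ_d : ℝ^D → ℝ^d` keeping the first `d` coordinates. -/
def truncate {d D : ℕ} (hd : d ≤ D) (x : EuclideanSpace ℝ (Fin D)) : EuclideanSpace ℝ (Fin d) :=
  WithLp.toLp 2 fun i => x (Fin.castLE hd i)

/-- The parameter space `Θ_d`: all coordinates after the first `d` vanish. -/
def paramSpace (D d : ℕ) : Set (EuclideanSpace ℝ (Fin D)) :=
  {θ | ∀ i : Fin D, d ≤ (i : ℕ) → θ i = 0}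

/-- The design matrix `A_d(λ) = ∑_{x ∈ X} λ_x ψ_d(x) ψ_d(x)ᵀ`. -/
def designMatrix {d D : ℕ} (hd : d ≤ D) (X : Finset (EuclideanSpace ℝ (Fin D)))
    (l : X → ℝ) : Matrix (Fin d) (Fin d) ℝ :=
  ∑ x : X, l x • Matrix.vecMulVec (truncate hd x.1) (truncate hd x.1)

/-- `‖y‖²_{A⁻¹}` for a symmetric positive semidefinite matrix `A`, with values in `[0, ∞]`:
it is `∞` when `y` is not in the range of `A`; when `y = A w` it is `wᵀ y = yᵀ A⁺ y`, which does
not depend on the choice of `w` (see `invNormSq_of_range`, `invNormSq_of_not_range`). -/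
def invNormSq {d : ℕ} (A : Matrix (Fin d) (Fin d) ℝ) (y : Fin d → ℝ) : ℝ≥0∞ :=
  ⨅ (w : Fin d → ℝ) (_ : A.mulVec w = y), ENNReal.ofReal (w ⬝ᵥ y)

/-- On the range of `A`, `invNormSq` is `yᵀ G y` for every generalized inverse `G` of `A`
(`A G A = A`), in particular for the Moore-Penrose pseudo-inverse and, if `A` is invertible,
for `A⁻¹`. -/
theorem invNormSq_of_range {d : ℕ} {A G : Matrix (Fin d) (Fin d) ℝ} (hA : A.transpose = A)
    (hG : A * G * A = A) {y : Fin d → ℝ} (hy : ∃ w, A.mulVec w = y) :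
    invNormSq A y = ENNReal.ofReal (y ⬝ᵥ G.mulVec y) := by
  have key : ∀ w : Fin d → ℝ, A.mulVec w = y → w ⬝ᵥ y = y ⬝ᵥ G.mulVec y := by
    intro w hw
    have h1 : y = A.mulVec (G.mulVec y) := by
      rw [← hw, Matrix.mulVec_mulVec, Matrix.mulVec_mulVec, hG]
    calc w ⬝ᵥ y = w ⬝ᵥ A.mulVec (G.mulVec y) := by rw [← h1]
      _ = Matrix.vecMul w A ⬝ᵥ G.mulVec y := Matrix.dotProduct_mulVec _ _ _
      _ = y ⬝ᵥ G.mulVec y := by rw [← Matrix.mulVec_transpose, hA, hw]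
  obtain ⟨w, hw⟩ := hy
  unfold invNormSq
  apply le_antisymm
  · exact (iInf₂_le w hw).trans (by rw [key w hw])
  · exact le_iInf₂ fun v hv => by rw [key v hv]

/-- Outside the range of `A`, `invNormSq` is infinite. -/
theorem invNormSq_of_not_range {d : ℕ} {A : Matrix (Fin d) (Fin d) ℝ} {y : Fin d → ℝ}
    (hy : ¬ ∃ w, A.mulVec w = y) : invNormSq A y = ⊤ := by
  simp only [not_exists] at hy
  simp [invNormSq, hy]

/-- The complexity
`ρ*_d = inf_{λ ∈ Δ_X} sup_{z ∈ Z, z ≠ z*} ‖ψ_d(z*) - ψ_d(z)‖²_{A_d(λ)⁻¹} / (h(z*) - h(z))²`,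
where `h(z) = ⟨θ*, z⟩`. -/
def rhoStar {d D : ℕ} (hd : d ≤ D) (X : Finset (EuclideanSpace ℝ (Fin D)))
    (Z : Set (EuclideanSpace ℝ (Fin D))) (θs zs : EuclideanSpace ℝ (Fin D)) : ℝ≥0∞ :=
  ⨅ l ∈ stdSimplex ℝ X, ⨆ z ∈ Z \ {zs},
    invNormSq (designMatrix hd X l) (truncate hd zs - truncate hd z)
      / ENNReal.ofReal ((inner ℝ θs zs - inner ℝ θs z) ^ 2)

/-- The set `argmin_{θ ∈ ℝ^d} ∑ i, (r i - ⟨θ, ψ_d(x i)⟩)²` of least-squares solutions. -/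
def leastSquares {d D N : ℕ} (hd : d ≤ D) (x : Fin N → EuclideanSpace ℝ (Fin D))
    (r : Fin N → ℝ) : Set (EuclideanSpace ℝ (Fin d)) :=
  {θ | ∀ θ' : EuclideanSpace ℝ (Fin d),
    ∑ i, (r i - inner ℝ θ (truncate hd (x i))) ^ 2
      ≤ ∑ i, (r i - inner ℝ θ' (truncate hd (x i))) ^ 2}

/-- The set `argmax_{z ∈ Z} ⟨θ, ψ_d(z)⟩` of arms that the parameter `θ ∈ ℝ^d` recommends. -/
def bestArms {d D : ℕ} (hd : d ≤ D) (Z : Set (EuclideanSpace ℝ (Fin D)))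
    (θ : EuclideanSpace ℝ (Fin d)) : Set (EuclideanSpace ℝ (Fin D)) :=
  {z | z ∈ Z ∧ ∀ z' ∈ Z, inner ℝ θ (truncate hd z') ≤ inner ℝ θ (truncate hd z)}

end LinearBandit

end

open MeasureTheory ProbabilityTheory
open scoped ENNReal NNReal

noncomputable section

namespace LinearBandit

/-! If the design has full rank, the estimated gap of an arm is a linear combination of the rewards.
It is Gaussian, and its mean is the true gap because `θs` lies in the model. By Cauchy-Schwarz its
variance in dimension `d` is at least the variance in dimension `dstar`, which is 1/N times the
squared norm in `rhoStar` at the empirical frequencies. A small `N` thus forces an arm whose squared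
gap is at most (2/3) log(1/δ) times its variance (`exists_gap_sq_le`), and a Gaussian with this
ratio is negative with probability at least δ (`le_gaussianReal_Iio_zero_of_sq_le`).

If the rank is deficient, kernel vectors can be added freely to a solution. Since the arm
differences span the space, some such shift reverses a ranking, whatever the rewards
(`exists_leastSquares_lt_of_not_injective`). -/

/-! ### Gaussian sums and tails -/

/-- A weighted sum of independent unit-variance Gaussian variables is Gaussian. -/
theorem map_sum_mul_gaussianReal {ι Ω : Type*} [Fintype ι] [MeasurableSpace Ω] {P : Measure Ω}
    [IsProbabilityMeasure P] {r : ι → Ω → ℝ} (hr : ∀ i, Measurable (r i))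
    (hindep : iIndepFun r P) {m : ι → ℝ} (hlaw : ∀ i, P.map (r i) = gaussianReal (m i) 1)
    (a : ι → ℝ) :
    P.map (fun ω => ∑ i, a i * r i ω)
      = gaussianReal (∑ i, a i * m i) (∑ i, (a i ^ 2)).toNNReal := by
  classical
  have hind : iIndepFun (fun i ω => a i * r i ω) P :=
    hindep.comp (fun i t => a i * t) fun i => measurable_const_mul (a i)
  have hmeas : ∀ i, Measurable (fun ω => a i * r i ω) := fun i => (hr i).const_mul (a i)
  have hone : ∀ i, P.map (fun ω => a i * r i ω) = gaussianReal (a i * m i) (a i ^ 2).toNNReal := by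
    intro i
    have := (gaussianReal_const_mul (X := r i) ⟨(hr i).aemeasurable, hlaw i⟩ (a i)).map_eq
    rw [this]
    congr 1
    ext
    simp [Real.toNNReal_of_nonneg (sq_nonneg (a i))]
  have key : ∀ s : Finset ι, P.map (fun ω => ∑ i ∈ s, a i * r i ω)
      = gaussianReal (∑ i ∈ s, a i * m i) (∑ i ∈ s, (a i ^ 2)).toNNReal := by
    intro s
    induction s using Finset.induction_on with
    | empty => simp [gaussianReal_zero_var, Measure.map_const]
    | insert i s hi ih =>
      have h := hind.indepFun_finsetSum_of_notMem hmeas hi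
      have hfun : (∑ j ∈ s, fun ω => a j * r j ω) = fun ω => ∑ j ∈ s, a j * r j ω := by
        ext ω; simp
      rw [hfun] at h
      have h2 := gaussianReal_add_gaussianReal_of_indepFun h.symm (hone i) ih
      simp only [Finset.sum_insert hi]
      rw [Real.toNNReal_add (sq_nonneg _) (Finset.sum_nonneg fun j _ => sq_nonneg _)]
      exact h2
  exact key Finset.univ

/-- A lower bound for the Gaussian mass of the negative half-line. -/
theorem le_gaussianReal_Iio_zero {m s : ℝ} (hs : 0 < s) (hm : 0 ≤ m) :
    (2 * √(2 * Real.pi))⁻¹ * Real.exp (-(m / s + 1 / 2) ^ 2 / 2)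
      ≤ (gaussianReal m (s ^ 2).toNNReal).real (Set.Iio 0) := by
  have hv : (s ^ 2).toNNReal ≠ 0 := by
    rw [ne_eq, Real.toNNReal_eq_zero, not_le]; positivity
  have hcoe : ((s ^ 2).toNNReal : ℝ) = s ^ 2 := Real.coe_toNNReal _ (sq_nonneg s)
  -- Half a standard deviation of mass suffices: on this interval the density is at least its value
  -- at the left endpoint.
  have hsub : Set.Ioo (-(s / 2)) 0 ⊆ Set.Iio (0 : ℝ) := fun t ht => ht.2
  refine le_trans ?_ (measureReal_mono hsub)
  rw [measureReal_def, gaussianReal_apply_eq_integral _ hv,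
    ENNReal.toReal_ofReal (integral_nonneg fun t => gaussianPDFReal_nonneg _ _ _)]
  have hconst : (2 * √(2 * Real.pi))⁻¹ * Real.exp (-(m / s + 1 / 2) ^ 2 / 2)
      = ∫ _ in Set.Ioo (-(s / 2)) 0,
        (√(2 * Real.pi * s ^ 2))⁻¹ * Real.exp (-(m / s + 1 / 2) ^ 2 / 2) := by
    rw [setIntegral_const, measureReal_def, Real.volume_Ioo,
      ENNReal.toReal_ofReal (by linarith),
      Real.sqrt_mul (by positivity : 0 ≤ 2 * Real.pi) (s ^ 2), Real.sqrt_sq hs.le,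
      smul_eq_mul]
    have : √(2 * Real.pi) ≠ 0 := by positivity
    field_simp
    ring
  rw [hconst]
  refine setIntegral_mono_on (integrableOn_const (by simp))
    (integrable_gaussianPDFReal _ _).integrableOn measurableSet_Ioo fun t ht => ?_
  rw [gaussianPDFReal, hcoe]
  refine mul_le_mul_of_nonneg_left (Real.exp_le_exp.2 ?_) (by positivity)
  have h1 : (t - m) ^ 2 ≤ (m + s / 2) ^ 2 := by
    apply sq_le_sq'
    · linarith [ht.1]
    · linarith [ht.2]
  have h2 : (m / s + 1 / 2) ^ 2 / 2 = (m + s / 2) ^ 2 / (2 * s ^ 2) := by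
    field_simp
  rw [neg_div, neg_div, h2]
  exact neg_le_neg (by gcongr)

/-- If the squared signal-to-noise ratio is at most `(2/3) log (1/δ)`, a Gaussian variable is
negative with probability at least `δ`. -/
theorem le_gaussianReal_Iio_zero_of_sq_le {m s δ : ℝ} (hs : 0 < s) (hm : 0 ≤ m) (hδ0 : 0 < δ)
    (hδ1 : δ ≤ 0.015) (h : m ^ 2 ≤ 2 / 3 * Real.log (1 / δ) * s ^ 2) :
    δ ≤ (gaussianReal m (s ^ 2).toNNReal).real (Set.Iio 0) := by
  refine le_trans ?_ (le_gaussianReal_Iio_zero hs hm)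
  set l := Real.log (1 / δ) with hl
  have hδ : δ = Real.exp (-l) := by
    rw [hl, one_div, Real.log_inv, neg_neg, Real.exp_log hδ0]
  have he1 := Real.exp_one_gt_d9
  have he2 := Real.exp_one_lt_d9
  have hl4 : 4 ≤ l := by
    rw [hl, Real.le_log_iff_exp_le (by positivity)]
    have h4 : Real.exp 4 = Real.exp 1 ^ 4 := by rw [← Real.exp_nat_mul]; norm_num
    have h5 : Real.exp 1 ^ 4 ≤ 2.7182818286 ^ 4 := by gcongr
    rw [h4, le_div_iff₀ hδ0]
    calc Real.exp 1 ^ 4 * δ ≤ 2.7182818286 ^ 4 * 0.015 := by gcongr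
      _ ≤ 1 := by norm_num
  have ht : (m / s) ^ 2 ≤ 2 / 3 * l := by
    rw [div_pow, div_le_iff₀ (by positivity)]; exact h
  set t := m / s
  -- The square gives t ≤ t²/3 + 3/4, so (t + 1/2)² ≤ (8/9) l + 1; with l ≥ 4 this leaves room for
  -- 3.44 = 2 · 1.72, where exp 1.72 absorbs the prefactor.
  have hexp : 3.44 - 2 * l ≤ 2 * (-(t + 1 / 2) ^ 2 / 2) := by
    nlinarith [sq_nonneg (t - 3 / 2)]
  have hπ := Real.pi_lt_d2
  have hroot : 2 * √(2 * Real.pi) ≤ Real.exp 1.72 := by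
    refine (sq_le_sq₀ (by positivity) (by positivity)).1 ?_
    have h3 : Real.exp 1.72 ^ 2 = Real.exp 1 ^ 3 * Real.exp 0.44 := by
      rw [← Real.exp_nat_mul, ← Real.exp_nat_mul, ← Real.exp_add]; norm_num
    have h4 : (2.7182818283 : ℝ) ^ 3 * 1.44 ≤ Real.exp 1 ^ 3 * Real.exp 0.44 := by
      gcongr
      linarith [Real.add_one_le_exp (0.44 : ℝ)]
    rw [mul_pow, Real.sq_sqrt (by positivity), h3]
    norm_num at h4 ⊢
    linarith
  rw [hδ, inv_mul_eq_div, le_div_iff₀ (by positivity)]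
  calc Real.exp (-l) * (2 * √(2 * Real.pi)) ≤ Real.exp (-l) * Real.exp 1.72 := by gcongr
    _ = Real.exp (-l + 1.72) := (Real.exp_add _ _).symm
    _ ≤ _ := by
      apply Real.exp_le_exp.2
      linarith

/-! ### Nested feature models -/

/-- Extension of a vector by zero coordinates. -/
def extendZero {d D : ℕ} (w : EuclideanSpace ℝ (Fin d)) : EuclideanSpace ℝ (Fin D) :=
  WithLp.toLp 2 fun i => if h : (i : ℕ) < d then w ⟨i, h⟩ else 0

theorem inner_extendZero {d D : ℕ} (hd : d ≤ D) (w : EuclideanSpace ℝ (Fin d))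
    (y : EuclideanSpace ℝ (Fin D)) :
    inner ℝ (extendZero w) y = inner ℝ w (truncate hd y) := by
  obtain ⟨k, rfl⟩ := Nat.exists_eq_add_of_le hd
  simp only [PiLp.inner_apply, Fin.sum_univ_add, extendZero, truncate]
  simp [Fin.castLE, Fin.castAdd]

theorem extendZero_truncate {d D : ℕ} (hd : d ≤ D) {θ : EuclideanSpace ℝ (Fin D)}
    (hθ : θ ∈ paramSpace D d) : extendZero (truncate hd θ) = θ := by
  ext i
  by_cases h : (i : ℕ) < d
  · simp [extendZero, truncate, h]
  · simp [extendZero, h, hθ i (not_lt.1 h)]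

theorem inner_truncate_truncate {d D : ℕ} (hd : d ≤ D) {θ : EuclideanSpace ℝ (Fin D)}
    (hθ : θ ∈ paramSpace D d) (y : EuclideanSpace ℝ (Fin D)) :
    inner ℝ (truncate hd θ) (truncate hd y) = inner ℝ θ y := by
  rw [← inner_extendZero, extendZero_truncate hd hθ]

theorem truncate_sub {d D : ℕ} (hd : d ≤ D) (y z : EuclideanSpace ℝ (Fin D)) :
    truncate hd (y - z) = truncate hd y - truncate hd z := by
  ext i; simp [truncate]

theorem paramSpace_mono {D d e : ℕ} (h : d ≤ e) : paramSpace D d ⊆ paramSpace D e :=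
  fun _ hθ i hi => hθ i (h.trans hi)

/-- The linear map sending a parameter to the vector of predicted rewards. -/
def designMap {d D N : ℕ} (hd : d ≤ D) (x : Fin N → EuclideanSpace ℝ (Fin D)) :
    EuclideanSpace ℝ (Fin d) →ₗ[ℝ] EuclideanSpace ℝ (Fin N) where
  toFun θ := WithLp.toLp 2 fun i => inner ℝ θ (truncate hd (x i))
  map_add' θ η := by ext i; simp [inner_add_left]
  map_smul' c θ := by ext i; simp [inner_smul_left]

theorem designMap_apply {d D N : ℕ} (hd : d ≤ D) (x : Fin N → EuclideanSpace ℝ (Fin D))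
    (θ : EuclideanSpace ℝ (Fin d)) (i : Fin N) :
    designMap hd x θ i = inner ℝ θ (truncate hd (x i)) := rfl

/-- The smaller model sits inside the larger one. This passes full rank downwards and makes
variances in two dimensions comparable. -/
theorem designMap_extendZero {d e D N : ℕ} (hd : d ≤ D) (hde : d ≤ e) (he : e ≤ D)
    (x : Fin N → EuclideanSpace ℝ (Fin D)) (w : EuclideanSpace ℝ (Fin d)) :
    designMap he x (extendZero w) = designMap hd x w := by
  ext i
  rw [designMap_apply, designMap_apply, inner_extendZero hde]
  rfl

theorem extendZero_injective {d D : ℕ} (hd : d ≤ D) :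
    Function.Injective (extendZero : EuclideanSpace ℝ (Fin d) → EuclideanSpace ℝ (Fin D)) := by
  intro v w h
  ext i
  have := congrArg (fun u : EuclideanSpace ℝ (Fin D) => u (Fin.castLE hd i)) h
  simpa [extendZero] using this

theorem designMap_injective_of_le {d e D N : ℕ} (hd : d ≤ D) (hde : d ≤ e) (he : e ≤ D)
    {x : Fin N → EuclideanSpace ℝ (Fin D)} (h : Function.Injective (designMap he x)) :
    Function.Injective (designMap hd x) := by
  intro v w hvw
  rw [← designMap_extendZero hd hde he, ← designMap_extendZero hd hde he] at hvw
  exact extendZero_injective hde (h hvw)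

/-! ### Least squares as orthogonal projection -/

theorem sum_sq_sub_inner_eq {d D N : ℕ} (hd : d ≤ D) (x : Fin N → EuclideanSpace ℝ (Fin D))
    (r : Fin N → ℝ) (θ : EuclideanSpace ℝ (Fin d)) :
    ∑ i, (r i - inner ℝ θ (truncate hd (x i))) ^ 2
      = ‖WithLp.toLp 2 r - designMap hd x θ‖ ^ 2 := by
  simp [EuclideanSpace.norm_sq_eq, designMap_apply]

theorem mem_leastSquares_iff {d D N : ℕ} (hd : d ≤ D) (x : Fin N → EuclideanSpace ℝ (Fin D))
    (r : Fin N → ℝ) (θ : EuclideanSpace ℝ (Fin d)) :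
    θ ∈ leastSquares hd x r ↔
      designMap hd x θ = (LinearMap.range (designMap hd x)).starProjection (WithLp.toLp 2 r) := by
  set K := LinearMap.range (designMap hd x)
  set R : EuclideanSpace ℝ (Fin N) := WithLp.toLp 2 r
  -- Pythagoras: only the second term depends on η, and it can be made zero.
  have hpyth : ∀ η, ‖R - designMap hd x η‖ ^ 2
      = ‖R - K.starProjection R‖ ^ 2 + ‖K.starProjection R - designMap hd x η‖ ^ 2 := by
    intro η
    have hmem : K.starProjection R - designMap hd x η ∈ K :=
      K.sub_mem (K.starProjection_apply_mem R) (LinearMap.mem_range_self _ η)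
    have h0 := K.starProjection_inner_eq_zero R _ hmem
    have := norm_add_sq_real (R - K.starProjection R) (K.starProjection R - designMap hd x η)
    rw [h0] at this
    rw [sub_add_sub_cancel] at this
    linarith
  obtain ⟨η, hη⟩ := K.starProjection_apply_mem R
  simp only [leastSquares, Set.mem_ofPred_eq, sum_sq_sub_inner_eq]
  constructor
  · intro h
    have h1 := h η
    rw [hpyth, hpyth η, hη] at h1
    have h2 : ‖K.starProjection R - designMap hd x θ‖ ^ 2 ≤ 0 := by simpa using h1
    have h3 : ‖K.starProjection R - designMap hd x θ‖ = 0 := by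
      nlinarith [norm_nonneg (K.starProjection R - designMap hd x θ)]
    exact (sub_eq_zero.1 (norm_eq_zero.1 h3)).symm
  · intro h θ'
    rw [hpyth, hpyth θ', h]
    rw [sub_self, norm_zero]
    nlinarith [sq_nonneg ‖K.starProjection R - designMap hd x θ'‖]

theorem leastSquares_nonempty {d D N : ℕ} (hd : d ≤ D) (x : Fin N → EuclideanSpace ℝ (Fin D))
    (r : Fin N → ℝ) : (leastSquares hd x r).Nonempty := by
  obtain ⟨θ, hθ⟩ := (LinearMap.range (designMap hd x)).starProjection_apply_mem (WithLp.toLp 2 r)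
  exact ⟨θ, (mem_leastSquares_iff hd x r θ).2 hθ⟩

theorem add_mem_leastSquares {d D N : ℕ} (hd : d ≤ D) {x : Fin N → EuclideanSpace ℝ (Fin D)}
    {r : Fin N → ℝ} {θ u : EuclideanSpace ℝ (Fin d)} (hθ : θ ∈ leastSquares hd x r)
    (hu : designMap hd x u = 0) : θ + u ∈ leastSquares hd x r := by
  rw [mem_leastSquares_iff] at hθ ⊢
  rw [map_add, hu, add_zero, hθ]

/-- Solutions may be shifted along the kernel, so uniqueness for a single reward vector already
determines the rank of the design. -/
theorem designMap_injective_of_leastSquares_eq_singleton {d D N : ℕ} (hd : d ≤ D)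
    {x : Fin N → EuclideanSpace ℝ (Fin D)} {r : Fin N → ℝ} {θ : EuclideanSpace ℝ (Fin d)}
    (h : leastSquares hd x r = {θ}) : Function.Injective (designMap hd x) := by
  rw [injective_iff_map_eq_zero]
  intro u hu
  have hθ : θ ∈ leastSquares hd x r := h ▸ Set.mem_singleton θ
  have h1 := add_mem_leastSquares hd hθ hu
  rw [h] at h1
  simpa using h1

/-- The normal equations. -/
theorem inner_designMap_of_mem_leastSquares {d D N : ℕ} (hd : d ≤ D)
    {x : Fin N → EuclideanSpace ℝ (Fin D)} {r : Fin N → ℝ} {θ : EuclideanSpace ℝ (Fin d)}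
    (hθ : θ ∈ leastSquares hd x r) (w : EuclideanSpace ℝ (Fin d)) :
    inner ℝ (designMap hd x θ) (designMap hd x w)
      = inner ℝ (WithLp.toLp 2 r) (designMap hd x w) := by
  rw [mem_leastSquares_iff] at hθ
  have := (LinearMap.range (designMap hd x)).starProjection_inner_eq_zero (WithLp.toLp 2 r) _
    (LinearMap.mem_range_self (designMap hd x) w)
  rw [inner_sub_left, ← hθ] at this
  linarith

/-- If the design has full rank, every linear functional is represented through it. -/
theorem exists_inner_designMap_eq {d D N : ℕ} (hd : d ≤ D)
    {x : Fin N → EuclideanSpace ℝ (Fin D)} (h : Function.Injective (designMap hd x))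
    (y : EuclideanSpace ℝ (Fin d)) :
    ∃ w, ∀ v, inner ℝ (designMap hd x v) (designMap hd x w) = inner ℝ v y := by
  -- The Gram operator is injective, hence surjective in finite dimension; `w` is a preimage of `y`.
  have hinj : Function.Injective ((designMap hd x).adjoint ∘ₗ designMap hd x) := by
    rw [← LinearMap.ker_eq_bot, LinearMap.ker_adjoint_comp_self, LinearMap.ker_eq_bot]
    exact h
  obtain ⟨w, hw⟩ := LinearMap.injective_iff_surjective.1 hinj y
  refine ⟨w, fun v => ?_⟩
  rw [← hw, LinearMap.comp_apply, LinearMap.adjoint_inner_right]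

/-! ### Empirical design and complexity -/

/-- The empirical frequencies of an allocation. -/
def empiricalWeights {D N : ℕ} (X : Finset (EuclideanSpace ℝ (Fin D)))
    (x : Fin N → EuclideanSpace ℝ (Fin D)) (a : X) : ℝ :=
  open Classical in ((Finset.univ.filter fun i => x i = a.1).card : ℝ) / N

theorem sum_empiricalWeights_mul {D N : ℕ} {X : Finset (EuclideanSpace ℝ (Fin D))}
    {x : Fin N → EuclideanSpace ℝ (Fin D)} (hx : ∀ i, x i ∈ X)
    (f : EuclideanSpace ℝ (Fin D) → ℝ) :
    ∑ a : X, empiricalWeights X x a * f a = (∑ i, f (x i)) / N := by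
  classical
  have h := Finset.sum_fiberwise (s := Finset.univ) (fun i => (⟨x i, hx i⟩ : X)) (fun i => f (x i))
  rw [← h, Finset.sum_div]
  refine Finset.sum_congr rfl fun a _ => ?_
  have h2 : ∀ i ∈ Finset.univ.filter (fun i => (⟨x i, hx i⟩ : X) = a), f (x i) = f a := by
    intro i hi
    rw [← (Finset.mem_filter.1 hi).2]
  rw [Finset.sum_congr rfl h2, Finset.sum_const, nsmul_eq_mul, empiricalWeights]
  have h3 : (Finset.univ.filter fun i => (⟨x i, hx i⟩ : X) = a)
      = Finset.univ.filter fun i => x i = a.1 := by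
    ext i; simp [Subtype.ext_iff]
  rw [h3]
  convert (div_mul_eq_mul_div _ _ _) using 3

theorem empiricalWeights_mem_stdSimplex {D N : ℕ} {X : Finset (EuclideanSpace ℝ (Fin D))}
    {x : Fin N → EuclideanSpace ℝ (Fin D)} (hx : ∀ i, x i ∈ X) (hN : 0 < N) :
    empiricalWeights X x ∈ stdSimplex ℝ X := by
  refine ⟨fun a => by unfold empiricalWeights; positivity, ?_⟩
  have := sum_empiricalWeights_mul hx fun _ => 1
  have hN' : (N : ℝ) ≠ 0 := by positivity
  simpa [hN'] using this

theorem dotProduct_ofLp {d : ℕ} (p q : EuclideanSpace ℝ (Fin d)) :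
    p.ofLp ⬝ᵥ q.ofLp = inner ℝ p q := by
  simp [PiLp.inner_apply, dotProduct, mul_comm]

theorem dotProduct_designMatrix_empiricalWeights {d D N : ℕ} (hd : d ≤ D)
    {X : Finset (EuclideanSpace ℝ (Fin D))} {x : Fin N → EuclideanSpace ℝ (Fin D)}
    (hx : ∀ i, x i ∈ X) (v w : EuclideanSpace ℝ (Fin d)) :
    v.ofLp ⬝ᵥ (designMatrix hd X (empiricalWeights X x)).mulVec w.ofLp
      = inner ℝ (designMap hd x v) (designMap hd x w) / N := by
  have h := sum_empiricalWeights_mul hx fun a =>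
    inner ℝ v (truncate hd a) * inner ℝ w (truncate hd a)
  rw [designMatrix, Matrix.sum_mulVec, dotProduct_sum]
  rw [PiLp.inner_apply]
  refine Eq.trans (Finset.sum_congr rfl fun a _ => ?_) (h.trans ?_)
  · rw [Matrix.smul_mulVec, Matrix.vecMulVec_mulVec, dotProduct_smul, op_smul_eq_smul, dotProduct_smul, dotProduct_ofLp,
      dotProduct_ofLp, real_inner_comm w]
    simp [mul_comm]
  · congr 1
    refine Finset.sum_congr rfl fun i _ => ?_
    rw [designMap_apply, designMap_apply, mul_comm]
    rfl

/-- On the empirical design, the variance proxy in dimension `d` is at most `N` times the variance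
of the least-squares estimate in any larger dimension. -/
theorem invNormSq_empiricalWeights_le {d e D N : ℕ} (hd : d ≤ D) (hde : d ≤ e) (he : e ≤ D)
    {X : Finset (EuclideanSpace ℝ (Fin D))} {x : Fin N → EuclideanSpace ℝ (Fin D)}
    (hx : ∀ i, x i ∈ X) (hN : 0 < N) (hinj : Function.Injective (designMap he x))
    {y : EuclideanSpace ℝ (Fin D)} {w : EuclideanSpace ℝ (Fin e)}
    (hw : ∀ v, inner ℝ (designMap he x v) (designMap he x w) = inner ℝ v (truncate he y)) :
    invNormSq (designMatrix hd X (empiricalWeights X x)) (truncate hd y)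
      ≤ ENNReal.ofReal (N * ‖designMap he x w‖ ^ 2) := by
  obtain ⟨u, hu⟩ := exists_inner_designMap_eq hd (designMap_injective_of_le hd hde he hinj)
    (truncate hd y)
  have hN' : (N : ℝ) ≠ 0 := by positivity
  -- Testing `hw` on the zero extension of `u` gives ⟨Φu, Φw⟩ = ‖Φu‖²; Cauchy-Schwarz concludes.
  have hnorm : ‖designMap hd x u‖ ≤ ‖designMap he x w‖ := by
    have h1 := hw (extendZero u)
    rw [inner_extendZero hde, designMap_extendZero hd hde he] at h1
    have h2 : inner ℝ (designMap hd x u) (designMap he x w) = ‖designMap hd x u‖ ^ 2 := by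
      rw [h1, ← real_inner_self_eq_norm_sq, hu]; rfl
    have h3 := real_inner_le_norm (designMap hd x u) (designMap he x w)
    rw [h2] at h3
    nlinarith [norm_nonneg (designMap hd x u), norm_nonneg (designMap he x w)]
  -- The design matrix is the Gram matrix divided by `N`, so the preimage is `N • u`.
  have hrange : (designMatrix hd X (empiricalWeights X x)).mulVec ((N : ℝ) • u).ofLp
      = (truncate hd y).ofLp := by
    refine dotProduct_eq _ _ fun v => ?_
    have := dotProduct_designMatrix_empiricalWeights hd hx (WithLp.toLp 2 v) ((N : ℝ) • u)
    rw [dotProduct_comm, this, map_smul, inner_smul_right, hu, mul_div_cancel_left₀ _ hN', ← dotProduct_ofLp,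
      dotProduct_comm]
  unfold invNormSq
  refine iInf₂_le_of_le _ hrange (ENNReal.ofReal_le_ofReal ?_)
  rw [dotProduct_ofLp, inner_smul_left, ← hu u, real_inner_self_eq_norm_sq]
  simp only [conj_trivial]
  gcongr

/-- A short sample leaves some arm whose gap is small relative to its noise level. -/
theorem exists_gap_sq_le {d e D N : ℕ} (hd : d ≤ D) (hde : d ≤ e) (he : e ≤ D)
    {X : Finset (EuclideanSpace ℝ (Fin D))} {Z : Set (EuclideanSpace ℝ (Fin D))}
    {θs zs : EuclideanSpace ℝ (Fin D)} {x : Fin N → EuclideanSpace ℝ (Fin D)}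
    (hx : ∀ i, x i ∈ X) (hNpos : 0 < N) {L : ℝ} (hL : 0 < L)
    (hbest : ∀ z ∈ Z, z ≠ zs → inner ℝ θs z < inner ℝ θs zs)
    (hN : (N : ℝ≥0∞) ≤ ENNReal.ofReal (1 / 2) * rhoStar hd X Z θs zs * ENNReal.ofReal L)
    (hinj : Function.Injective (designMap he x)) :
    ∃ z ∈ Z, z ≠ zs ∧ ∀ w, (∀ v, inner ℝ (designMap he x v) (designMap he x w)
        = inner ℝ v (truncate he (zs - z))) →
      (inner ℝ θs zs - inner ℝ θs z) ^ 2 ≤ 2 / 3 * L * ‖designMap he x w‖ ^ 2 := by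
  by_contra! hcon
  have hNr : (0 : ℝ) < N := by positivity
  have hrho : rhoStar hd X Z θs zs ≤ ENNReal.ofReal (N * (3 / 2) / L) := by
    refine (iInf₂_le _ (empiricalWeights_mem_stdSimplex hx hNpos)).trans ?_
    refine iSup₂_le fun z hz => ?_
    obtain ⟨w, hw, hlt⟩ := hcon z hz.1 hz.2
    have hgap : 0 < inner ℝ θs zs - inner ℝ θs z := sub_pos.2 (hbest z hz.1 hz.2)
    have h1 := invNormSq_empiricalWeights_le hd hde he hx hNpos hinj hw
    rw [truncate_sub] at h1
    refine (ENNReal.div_le_div_right h1 _).trans ?_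
    rw [← ENNReal.ofReal_div_of_pos (by positivity)]
    apply ENNReal.ofReal_le_ofReal
    rw [div_le_div_iff₀ (by positivity) hL]
    nlinarith
  have h2 : (N : ℝ≥0∞) ≤ ENNReal.ofReal (1 / 2) * ENNReal.ofReal (N * (3 / 2) / L)
      * ENNReal.ofReal L := hN.trans (by gcongr)
  rw [← ENNReal.ofReal_mul (by positivity), ← ENNReal.ofReal_mul (by positivity),
    ← ENNReal.ofReal_natCast, ENNReal.ofReal_le_ofReal_iff (by positivity)] at h2
  -- The supremum in `rhoStar` need not be attained. Relaxing 1/2 to 2/3 leaves the strict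
  -- contradiction N ≤ (3/4) N.
  have h3 : 1 / 2 * (N * (3 / 2) / L) * L = N * (3 / 4) := by field_simp; norm_num
  rw [h3] at h2
  linarith

/-- A full-rank design that can express a parameter with a unique best arm is nonempty. -/
theorem pos_of_designMap_injective {d D N : ℕ} (hD : 0 < D) (hd : d ≤ D)
    {Z : Set (EuclideanSpace ℝ (Fin D))} {θs zs : EuclideanSpace ℝ (Fin D)}
    (hZ : Submodule.span ℝ ((fun z => zs - z) '' Z) = ⊤)
    (hθs : θs ∈ paramSpace D d)
    (hbest : ∀ z ∈ Z, z ≠ zs → inner ℝ θs z < inner ℝ θs zs)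
    {x : Fin N → EuclideanSpace ℝ (Fin D)} (hinj : Function.Injective (designMap hd x)) :
    0 < N := by
  rcases Nat.eq_zero_or_pos N with rfl | h
  · exfalso
    have h0 : truncate hd θs = 0 := hinj (Subsingleton.elim _ _)
    have hall : ∀ z ∈ Z, z = zs := by
      intro z hz
      by_contra hne
      have := hbest z hz hne
      rw [← inner_truncate_truncate hd hθs, ← inner_truncate_truncate hd hθs, h0] at this
      simp at this
    have hle : Submodule.span ℝ ((fun z => zs - z) '' Z) ≤ ⊥ := by
      rw [Submodule.span_le]
      rintro _ ⟨z, hz, rfl⟩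
      simp [hall z hz]
    have : Nonempty (Fin D) := ⟨⟨0, hD⟩⟩
    rw [hZ] at hle
    exact top_ne_bot (le_bot_iff.1 hle)
  · exact h

/-! ### Failure of the estimator -/

/-- With a full-rank design and a short sample, with probability at least `δ` every least-squares
solution ranks some arm strictly above the best one. -/
theorem le_measureReal_of_injective {d e D N : ℕ} (hd : d ≤ D) (hde : d ≤ e) (he : e ≤ D)
    {X : Finset (EuclideanSpace ℝ (Fin D))} {Z : Set (EuclideanSpace ℝ (Fin D))}
    {θs zs : EuclideanSpace ℝ (Fin D)} {x : Fin N → EuclideanSpace ℝ (Fin D)}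
    (hx : ∀ i, x i ∈ X) (hNpos : 0 < N) {δ : ℝ} (hδ0 : 0 < δ) (hδ1 : δ ≤ 0.015)
    (hθs : θs ∈ paramSpace D d)
    (hbest : ∀ z ∈ Z, z ≠ zs → inner ℝ θs z < inner ℝ θs zs)
    (hN : (N : ℝ≥0∞) ≤ ENNReal.ofReal (1 / 2) * rhoStar hd X Z θs zs
      * ENNReal.ofReal (Real.log (1 / δ)))
    (hinj : Function.Injective (designMap he x))
    {Ω : Type*} [MeasurableSpace Ω] (P : Measure Ω) [IsProbabilityMeasure P]
    {r : Fin N → Ω → ℝ} (hr : ∀ i, Measurable (r i)) (hindep : iIndepFun r P)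
    (hlaw : ∀ i, P.map (r i) = gaussianReal (inner ℝ θs (x i)) 1) :
    δ ≤ P.real {ω | ∀ θ ∈ leastSquares he x (fun i => r i ω),
      ∃ z ∈ Z, inner ℝ θ (truncate he zs) < inner ℝ θ (truncate he z)} := by
  have hL : 0 < Real.log (1 / δ) :=
    Real.log_pos (by rw [lt_div_iff₀ hδ0]; linarith)
  obtain ⟨z, hz, hne, hzw⟩ := exists_gap_sq_le hd hde he hx hNpos hL hbest hN hinj
  obtain ⟨w, hw⟩ := exists_inner_designMap_eq he hinj (truncate he (zs - z))
  have hgap : 0 < inner ℝ θs zs - inner ℝ θs z := sub_pos.2 (hbest z hz hne)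
  have hsq := hzw w hw
  set a := designMap he x w with ha
  have hθe := paramSpace_mono hde hθs
  have hmean : ∑ i, a i * inner ℝ θs (x i) = inner ℝ θs zs - inner ℝ θs z := by
    have h1 := hw (truncate he θs)
    rw [inner_truncate_truncate he hθe, inner_sub_right] at h1
    rw [← h1, PiLp.inner_apply]
    refine Finset.sum_congr rfl fun i _ => ?_
    rw [designMap_apply he x (truncate he θs), inner_truncate_truncate he hθe]
    rfl
  -- Without noise the bound `hsq` would make the positive gap vanish.
  have hapos : 0 < ‖a‖ := by
    by_contra h
    have h0 : ‖a‖ = 0 := le_antisymm (not_lt.1 h) (norm_nonneg a)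
    rw [h0] at hsq
    nlinarith
  have hmap := map_sum_mul_gaussianReal hr hindep hlaw a
  have hvar : ∑ i, a i ^ 2 = ‖a‖ ^ 2 := by simp [EuclideanSpace.norm_sq_eq]
  rw [hmean, hvar] at hmap
  have htail := le_gaussianReal_Iio_zero_of_sq_le hapos hgap.le hδ0 hδ1 hsq
  rw [← hmap, map_measureReal_apply (by fun_prop) measurableSet_Iio] at htail
  refine htail.trans (measureReal_mono fun ω hω θ hθ => ⟨z, hz, ?_⟩)
  have h1 := inner_designMap_of_mem_leastSquares he hθ w
  rw [hw, truncate_sub, inner_sub_right, PiLp.inner_apply] at h1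
  have h2 : ∑ i, a i * r i ω < 0 := hω
  have h3 : inner ℝ θ (truncate he zs) - inner ℝ θ (truncate he z) = ∑ i, a i * r i ω := h1
  linarith

/-- A rank-deficient design admits a least-squares solution that ranks some arm strictly above
any given one. -/
theorem exists_leastSquares_lt_of_not_injective {d D N : ℕ} (hd : d ≤ D)
    {Z : Set (EuclideanSpace ℝ (Fin D))} {zs : EuclideanSpace ℝ (Fin D)}
    (hZ : Submodule.span ℝ ((fun z => zs - z) '' Z) = ⊤)
    {x : Fin N → EuclideanSpace ℝ (Fin D)} (h : ¬ Function.Injective (designMap hd x))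
    (r : Fin N → ℝ) :
    ∃ θ ∈ leastSquares hd x r, ∃ z ∈ Z,
      inner ℝ θ (truncate hd zs) < inner ℝ θ (truncate hd z) := by
  rw [injective_iff_map_eq_zero] at h
  push Not at h
  obtain ⟨u, hu, hu0⟩ := h
  obtain ⟨z, hz, hne⟩ : ∃ z ∈ Z, inner ℝ u (truncate hd (zs - z)) ≠ 0 := by
    -- Otherwise the zero extension of `u` is orthogonal to a spanning set, hence zero.
    by_contra! hall
    have hle : Submodule.span ℝ ((fun z => zs - z) '' Z)
        ≤ LinearMap.ker (innerₛₗ ℝ (extendZero u : EuclideanSpace ℝ (Fin D))) := by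
      rw [Submodule.span_le]
      rintro _ ⟨z, hz, rfl⟩
      simpa [inner_extendZero hd] using hall z hz
    rw [hZ] at hle
    have h0 : inner ℝ (extendZero u : EuclideanSpace ℝ (Fin D)) (extendZero u) = 0 :=
      hle (Submodule.mem_top (x := extendZero u))
    have h1 : (extendZero u : EuclideanSpace ℝ (Fin D)) = 0 := inner_self_eq_zero.1 h0
    refine hu0 (extendZero_injective hd (h1.trans ?_))
    ext i; simp [extendZero]
  obtain ⟨θ, hθ⟩ := leastSquares_nonempty hd x r
  set c := inner ℝ u (truncate hd (zs - z)) with hc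
  set b := inner ℝ θ (truncate hd (zs - z)) with hb
  -- The coefficient moves the estimated gap from b to -1.
  refine ⟨θ + (-(b + 1) / c) • u, add_mem_leastSquares hd hθ (by rw [map_smul, hu, smul_zero]),
    z, hz, ?_⟩
  have h2 : inner ℝ (θ + (-(b + 1) / c) • u) (truncate hd (zs - z)) = -1 := by
    rw [inner_add_left, inner_smul_left, ← hc, ← hb]
    simp only [conj_trivial]
    field_simp
    ring
  rw [truncate_sub, inner_sub_right] at h2
  linarith

end LinearBandit

end

theorem mainTheorem4
    {D dstar : ℕ} (hD : 0 < D) (hdstar : dstar ≤ D)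
    (X : Finset (EuclideanSpace ℝ (Fin D))) (Z : Set (EuclideanSpace ℝ (Fin D)))
    (θs zs : EuclideanSpace ℝ (Fin D))
    (hX : Submodule.span ℝ (X : Set (EuclideanSpace ℝ (Fin D))) = ⊤)
    (hZ : Submodule.span ℝ ((fun z => zs - z) '' Z) = ⊤)
    (hzs : zs ∈ Z) (hbest : ∀ z ∈ Z, z ≠ zs → inner ℝ θs z < inner ℝ θs zs)
    (hθs : θs ∈ LinearBandit.paramSpace D dstar)
    (δ : ℝ) (hδ0 : 0 < δ) (hδ1 : δ ≤ 0.015)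
    -- the non-interactive algorithm: feature dimension, sample size and fixed allocation
    (d : ℕ) (hd : dstar ≤ d) (hdD : d ≤ D)
    (N : ℕ) (x : Fin N → EuclideanSpace ℝ (Fin D)) (hx : ∀ i, x i ∈ X)
    (hN : (N : ℝ≥0∞) ≤
      ENNReal.ofReal (1 / 2) * LinearBandit.rhoStar hdstar X Z θs zs
        * ENNReal.ofReal (Real.log (1 / δ)))
    -- the independent Gaussian rewards
    {Ω : Type*} [MeasurableSpace Ω] (P : Measure Ω) [IsProbabilityMeasure P]
    (r : Fin N → Ω → ℝ) (hr : ∀ i, Measurable (r i)) (hindep : iIndepFun r P)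
    (hlaw : ∀ i, P.map (r i) = gaussianReal (inner ℝ θs (x i)) 1) :
    -- whenever the least-squares estimator is well defined, the recommendation errs,
    -- however ties in the final maximization are broken
    (∀ (θhat : Ω → EuclideanSpace ℝ (Fin d)) (zhat : Ω → EuclideanSpace ℝ (Fin D)),
      (∀ ω, LinearBandit.leastSquares hdD x (fun i => r i ω) = {θhat ω}) →
      (∀ ω, zhat ω ∈ LinearBandit.bestArms hdD Z (θhat ω)) →
      δ ≤ P.real {ω | zhat ω ≠ zs}) ∧
    -- for every allocation, also one with several least-squares solutions,
    -- least squares fails to single out the best arm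
    δ ≤ P.real {ω | ∃ θ ∈ LinearBandit.leastSquares hdD x (fun i => r i ω),
      LinearBandit.bestArms hdD Z θ ≠ {zs}} := by
  have hwrong : ∀ {θ : EuclideanSpace ℝ (Fin d)}, (∃ z ∈ Z,
      inner ℝ θ (LinearBandit.truncate hdD zs) < inner ℝ θ (LinearBandit.truncate hdD z)) →
      zs ∉ LinearBandit.bestArms hdD Z θ := by
    rintro θ ⟨z, hz, hlt⟩ ⟨_, hmax⟩
    exact absurd (hmax z hz) (not_le.2 hlt)
  have hmain : Function.Injective (LinearBandit.designMap hdD x) →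
      δ ≤ P.real {ω | ∀ θ ∈ LinearBandit.leastSquares hdD x (fun i => r i ω), ∃ z ∈ Z,
        inner ℝ θ (LinearBandit.truncate hdD zs)
          < inner ℝ θ (LinearBandit.truncate hdD z)} := by
    intro hinj
    refine LinearBandit.le_measureReal_of_injective hdstar hd hdD hx ?_ hδ0 hδ1 hθs hbest hN hinj P
      hr hindep hlaw
    exact LinearBandit.pos_of_designMap_injective hD hdD hZ (LinearBandit.paramSpace_mono hd hθs)
      hbest hinj
  constructor
  · intro θhat zhat hθhat hzhat
    -- One outcome suffices, as the rank does not depend on the rewards.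
    obtain ⟨ω₀⟩ := P.nonempty_of_neZero
    have hinj := LinearBandit.designMap_injective_of_leastSquares_eq_singleton hdD (hθhat ω₀)
    refine (hmain hinj).trans (measureReal_mono fun ω hω heq => ?_)
    refine hwrong (hω (θhat ω) (by rw [hθhat ω]; rfl)) ?_
    rw [← heq]
    exact hzhat ω
  · by_cases hinj : Function.Injective (LinearBandit.designMap hdD x)
    · refine (hmain hinj).trans (measureReal_mono fun ω hω => ?_)
      obtain ⟨θ, hθ⟩ := LinearBandit.leastSquares_nonempty hdD x fun i => r i ω
      refine ⟨θ, hθ, fun h => hwrong (hω θ hθ) ?_⟩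
      rw [h]; rfl
    · have huniv : {ω | ∃ θ ∈ LinearBandit.leastSquares hdD x (fun i => r i ω),
          LinearBandit.bestArms hdD Z θ ≠ {zs}} = Set.univ := by
        refine Set.eq_univ_of_forall fun ω => ?_
        obtain ⟨θ, hθ, hlt⟩ := LinearBandit.exists_leastSquares_lt_of_not_injective hdD hZ hinj
          fun i => r i ω
        refine ⟨θ, hθ, fun h => hwrong hlt ?_⟩
        rw [h]; rfl
      rw [huniv, probReal_univ]
      linarith
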